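/- Let $W$ be a standard Wiener process, $B(t)=W(t)-tW(1)$, $t\in[0,1]$, the Brownian bridge, and let $t_{\min}$ be the (first, and almost surely unique) time in $[0,1]$ at which $B$ attains its minimum. A Brownian excursion is a random continuous function $\mathbf e$ on $[0,1]$ with the same law as the path that equals $B(t+t_{\min})-B(t_{\min})$ for $0\le t\le 1-t_{\min}$ and $B(t-1+t_{\min})-B(t_{\min})$ for $1-t_{\min}<t\le 1$. The Brownian continuum random tree $T_{\mathbf e}$ is the quotient of $[0,1]$ by the relation $d_{\mathbf e}(x,y)=0$, with the metric induced by \[ d_{\mathbf e}(x,y)=\mathbf e(x)+\mathbf e(y)-2\min\{\mathbf e(t):\min\{x,y\}\le t\le\max\{x,y\}\}. \] Let $A>1$ and $0<\eta<1$ with $1+\eta<A-\eta$. Points $x_0,\dots,x_n$ of a metric space $(X,d)$ form an $(A,\eta)$-approximate $n$-star if there is $\varrho>0$ with $(A-\eta)\varrho\le d(x_i,x_j)\le A\varrho$ for all distinct $i,j\in\{1,\dots,n\}$ and $\varrho\le d(x_0,x_i)\le(1+\eta)\varrho$ for all $i\in\{1,\dots,n\}$. The space is starry if there are $A>1$ and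 $0<\eta<(A-1)/2$ such that for every $n$ it contains an $(A_n,\eta)$-approximate $n$-star for some $A_n\ge A$. With $N(S,r)\in\mathbb N\cup\{\infty\}$ the least number of sets of diameter at most $r$ needed to cover $S$, and $B(x,R)$ the closed ball, the Assouad dimension $\dim_A X$ is the infimum (with $\inf\varnothing=\infty$) of all $\alpha\ge 0$ for which there is $C>0$ with $N(B(x,R),r)\le C(R/r)^\alpha$ for all $0<r<R<1$ and $x\in X$. The space is doubling if there is $K$ such that every ball of radius $r>0$ is covered by at most $K$ balls of radius $r/2$. A quasisymmetric embedding $\phi:X\to Y$ is a homeomorphism onto its image for which there is an increasing function $\Psi:(0,\infty)\to(0,\infty)$ with $\frac{d_Y(\phi(x),\phi(y))}{d_Y(\phi(x),\phi(z))}\le\Psi\big(\frac{d_X(x,y)}{d_X(x,z)}\big)$ for all distinct $x,y,z\in X$. Theorem. There are constants $A>1$ and $0<\eta<(A-1)/2$ such that for every $n$ there is $A_n\ge A$ for which, almost surely, $T_{\mathbf e}$ contains infinitely many $(A_n,\eta)$-approximate $n$-stars. In particular, almost surely: $T_{\mathbf e}$ is starry, $\dim_A T_{\mathbf e}=\infty$,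 and $T_{\mathbf e}$ admits no quasisymmetric embedding into any doubling metric space. -/

import Mathlib

open MeasureTheory ProbabilityTheory
open scoped NNReal ENNReal

universe u v w

namespace BrownianCRT

noncomputable section

/-! ### Approximate stars and starry spaces -/

/-- The points `x 0, x 1, …, x n` of a metric space form an `(A, η)`-approximate `n`-star, with
centre `x 0` and some size `ϱ > 0`. -/
def IsApproxStar {X : Type*} [MetricSpace X] (A η : ℝ) {n : ℕ} (x : Fin (n + 1) → X) : Prop :=
  1 < A ∧ 0 < η ∧ η < 1 ∧ 1 + η < A - η ∧
    ∃ ϱ : ℝ, 0 < ϱ ∧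
      (∀ i j : Fin n, i ≠ j →
        (A - η) * ϱ ≤ dist (x i.succ) (x j.succ) ∧ dist (x i.succ) (x j.succ) ≤ A * ϱ) ∧
      (∀ i : Fin n, ϱ ≤ dist (x 0) (x i.succ) ∧ dist (x 0) (x i.succ) ≤ (1 + η) * ϱ)

/-- A metric space is starry if, for some uniform `A > 1` and `0 < η < (A - 1) / 2`, it contains
an `(Aₙ, η)`-approximate `n`-star with `A ≤ Aₙ`, for every `n`. -/
def IsStarry (X : Type*) [MetricSpace X] : Prop :=
  ∃ A η : ℝ, 1 < A ∧ 0 < η ∧ η < (A - 1) / 2 ∧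
    ∀ n : ℕ, ∃ A' : ℝ, A ≤ A' ∧ ∃ x : Fin (n + 1) → X, IsApproxStar A' η x

/-! ### Assouad dimension, doubling spaces, quasisymmetric embeddings -/

/-- The minimal number of sets of diameter at most `r` needed to cover `S`
(it is `∞` if no finite collection does). -/
def coverNumber {X : Type*} [MetricSpace X] (S : Set X) (r : ℝ) : ℕ∞ :=
  ⨅ (𝒰 : Set (Set X)) (_ : S ⊆ ⋃₀ 𝒰 ∧ ∀ U ∈ 𝒰, Metric.ediam U ≤ ENNReal.ofReal r), 𝒰.encard

/-- The Assouad dimension of a metric space; it is `∞` if no exponent is admissible. -/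
def assouadDim (X : Type*) [MetricSpace X] : ℝ≥0∞ :=
  ⨅ (α : ℝ≥0) (_ : ∃ C : ℝ, 0 < C ∧ ∀ r R : ℝ, 0 < r → r < R → R < 1 → ∀ x : X,
    (coverNumber (Metric.closedBall x R) r : ℝ≥0∞) ≤ ENNReal.ofReal (C * (R / r) ^ (α : ℝ))),
    (α : ℝ≥0∞)

/-- A metric space is doubling if every ball of radius `r` is covered by at most `K` balls of
radius `r / 2`, for some constant `K`. -/
def IsDoubling (X : Type*) [MetricSpace X] : Prop :=
  ∃ K : ℕ, ∀ (x : X) (r : ℝ), 0 < r →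
    ∃ t : Finset X, t.card ≤ K ∧ Metric.closedBall x r ⊆ ⋃ y ∈ t, Metric.closedBall y (r / 2)

/-- `φ` is a quasisymmetric embedding: a homeomorphism onto its image (with the induced metric)
that distorts ratios of distances in a way controlled by an increasing function
`Ψ : (0, ∞) → (0, ∞)`. -/
def IsQuasisymmetricEmbedding {X Y : Type*} [MetricSpace X] [MetricSpace Y] (φ : X → Y) : Prop :=
  Topology.IsEmbedding φ ∧
    ∃ Ψ : ℝ → ℝ, MonotoneOn Ψ (Set.Ioi 0) ∧ (∀ s : ℝ, 0 < s → 0 < Ψ s) ∧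
      ∀ x y z : X, x ≠ y → y ≠ z → x ≠ z →
        dist (φ x) (φ y) / dist (φ x) (φ z) ≤ Ψ (dist x y / dist x z)

/-! ### The continuum tree of a continuous function on `[0, 1]` -/

/-- `d_f(x, y) = f(x) + f(y) - 2 min {f(t) : min{x, y} ≤ t ≤ max{x, y}}`. -/
def treeDist (f : C(unitInterval, ℝ)) (x y : unitInterval) : ℝ :=
  f x + f y - 2 * sInf (f '' Set.uIcc x y)

lemma sInf_le_of_mem (f : C(unitInterval, ℝ)) {x y t : unitInterval} (ht : t ∈ Set.uIcc x y) :
    sInf (f '' Set.uIcc x y) ≤ f t :=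
  csInf_le (((isCompact_univ.image f.continuous).bddBelow).mono
    (Set.image_mono (Set.subset_univ _))) ⟨t, ht, rfl⟩

lemma treeDist_self (f : C(unitInterval, ℝ)) (x : unitInterval) : treeDist f x x = 0 := by
  rw [treeDist, Set.uIcc_self, Set.image_singleton, csInf_singleton]
  ring

lemma treeDist_comm (f : C(unitInterval, ℝ)) (x y : unitInterval) :
    treeDist f x y = treeDist f y x := by
  rw [treeDist, treeDist, Set.uIcc_comm, add_comm (f x)]

lemma treeDist_triangle (f : C(unitInterval, ℝ)) (x y z : unitInterval) :
    treeDist f x z ≤ treeDist f x y + treeDist f y z := by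
  have h1 : sInf (f '' Set.uIcc x y) ≤ f y := sInf_le_of_mem f Set.right_mem_uIcc
  have h2 : sInf (f '' Set.uIcc y z) ≤ f y := sInf_le_of_mem f Set.left_mem_uIcc
  have h3 : sInf (f '' Set.uIcc x y) + sInf (f '' Set.uIcc y z) - f y ≤
      sInf (f '' Set.uIcc x z) := by
    refine le_csInf (Set.nonempty_uIcc.image f) ?_
    rintro _ ⟨t, ht, rfl⟩
    rcases Set.uIcc_subset_uIcc_union_uIcc (b := y) ht with h | h
    · linarith [sInf_le_of_mem f h]
    · linarith [sInf_le_of_mem f h]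
  simp only [treeDist]
  linarith

/-- The interval `[0, 1]` carrying the pseudometric `d_f`. -/
def PreTree (_f : C(unitInterval, ℝ)) : Type := unitInterval

instance instPreTree (f : C(unitInterval, ℝ)) : PseudoMetricSpace (PreTree f) where
  dist := treeDist f
  dist_self := treeDist_self f
  dist_comm := treeDist_comm f
  dist_triangle := treeDist_triangle f

/-- The continuum tree `T_f = [0, 1] / ≈` with the metric induced by `d_f`, where `x ≈ y` if and
only if `d_f(x, y) = 0`. -/
abbrev ContinuumTree (f : C(unitInterval, ℝ)) : Type := SeparationQuotient (PreTree f)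

/-! ### The Brownian excursion -/

/-- The bridge `B(t) = W(t) - t W(1)` of a path `W`, used for `t ∈ [0, 1]`. -/
def bridge (W : ℝ≥0 → ℝ) (t : ℝ) : ℝ := W t.toNNReal - t * W 1

/-- The (first) time at which `B` attains its minimum over `[0, 1]`. -/
def argminTime (B : ℝ → ℝ) : ℝ := sInf {t ∈ Set.Icc (0 : ℝ) 1 | IsMinOn B (Set.Icc 0 1) t}

/-- The path `B` on `[0, 1]`, cut at the time of its minimum and translated. -/
def cutAtMin (B : ℝ → ℝ) (t : ℝ) : ℝ :=
  if t ≤ 1 - argminTime B then B (t + argminTime B) - B (argminTime B)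
  else B (t - 1 + argminTime B) - B (argminTime B)

/-- A random continuous function `e` on `[0, 1]` is a Brownian excursion if it has the law (the
finite-dimensional distributions) of the path obtained from a Brownian bridge
`B(t) = W(t) - t W(1)`, `W` a Wiener process, by cutting at the minimum and translating. -/
def IsBrownianExcursion {Ω : Type u} [MeasurableSpace Ω] (e : Ω → C(unitInterval, ℝ))
    (P : Measure Ω) : Prop :=
  ∃ (Ω' : Type v) (_ : MeasurableSpace Ω') (P' : Measure Ω') (W : ℝ≥0 → Ω' → ℝ),
    IsBrownianReal W P' ∧
    ∀ J : Finset unitInterval,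
      IdentDistrib (fun ω (t : J) ↦ e ω t)
        (fun ω' (t : J) ↦ cutAtMin (bridge (fun s ↦ W s ω')) (t : unitInterval)) P P'

end

end BrownianCRT

open BrownianCRT

/-!
The stars are found in the path of the Brownian motion. If a path follows, over some interval and
up to a small multiple of `ϱ`, a wave that rises `n` times from level `0` to level `ϱ` and falls
back, then the tree it codes contains a star: the starting point is the centre, the `n` peaks are
the leaves, the distances from the centre are about `ϱ`, and two leaves are at distance about `2ϱ`
because the path returns to level `0` between them (`exists_isTreeStar_of_near_wave_on`). All stars
below have `A = 9 / 4` and `η = 1 / 4`, whatever the number of leaves.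

Brownian motion stays uniformly close to any given continuous path over `[0, 1]` with positive
probability (`measure_near_pos`). Indeed `[0, 1]` can be cut into so many equal cells that the
bridges over the cells are as small as required with positive probability; the bridges are
independent of the increments over the cells, and the increments are independent Gaussian variables,
which approximate those of the given path with positive probability. By scaling, the corresponding
events over intervals `[t, t + h]` all have the same probability, and for disjoint intervals they
are independent, so the second Borel-Cantelli lemma gives waves of height `√h` on infinitely many of
a sequence of disjoint intervals that shrink to `0` (`ae_frequently_near`). Passing to the Brownian
bridge adds a drift of order `h`, which is negligible compared with `√h`, and cutting the bridge at
its minimum only translates the intervals that lie on one side of the time of the minimum, which are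
all but finitely many. Hence the path that defines the excursion has stars of arbitrarily small size
(`ae_exists_hasSmallStars_cutAtMin`).

This property is a `Gδ` condition on continuous paths, so it passes to every continuous process with
the same finite-dimensional distributions (`ae_mem_of_identDistrib`). Stars of arbitrarily small
size are infinitely many; a star of size `ϱ` with `n` leaves shows that a ball of radius `5ϱ/4`
cannot be covered by fewer than `n` sets of diameter at most `ϱ`, whence the Assouad dimension is
infinite; and a quasisymmetric embedding would map the leaves to arbitrarily many points of a ball
that are separated by a fixed proportion of its radius, which is impossible in a doubling space.
-/

namespace BrownianCRT

/-! ### Stars in the tree of a path -/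

/-- The point of the continuum tree coded by a point of the unit interval. -/
noncomputable def toTree (f : C(unitInterval, ℝ)) (x : unitInterval) : ContinuumTree f :=
  SeparationQuotient.mk (X := PreTree f) x

lemma dist_toTree (f : C(unitInterval, ℝ)) (x y : unitInterval) :
    dist (toTree f x) (toTree f y) = treeDist f x y :=
  SeparationQuotient.dist_mk (α := PreTree f) x y

lemma continuous_treeDist (x y : unitInterval) :
    Continuous fun f : C(unitInterval, ℝ) ↦ treeDist f x y := by
  have h : Continuous fun f : C(unitInterval, ℝ) ↦ sInf (f '' Set.uIcc x y) :=
    IsCompact.continuous_sInf (f := fun (f : C(unitInterval, ℝ)) t ↦ f t) isCompact_uIcc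
      ContinuousEval.continuous_eval
  unfold treeDist
  fun_prop

/-- The points `x 0, …, x n` of `[0, 1]` code a star of size `ϱ` in the tree of `f`, with centre
`x 0`, all of whose defining inequalities are strict. Strictness makes this an open condition
on `f`. -/
def IsTreeStar (f : C(unitInterval, ℝ)) (ϱ : ℝ) {n : ℕ} (x : Fin (n + 1) → unitInterval) : Prop :=
  (∀ i j : Fin n, i ≠ j → 2 * ϱ < treeDist f (x i.succ) (x j.succ) ∧
    treeDist f (x i.succ) (x j.succ) < 9 / 4 * ϱ) ∧
  ∀ i : Fin n, ϱ < treeDist f (x 0) (x i.succ) ∧ treeDist f (x 0) (x i.succ) < 5 / 4 * ϱ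

/-- The tree of `f` contains stars with `n` leaves of arbitrarily small size. -/
def HasSmallStars (n : ℕ) (f : C(unitInterval, ℝ)) : Prop :=
  ∀ m : ℕ, ∃ ϱ : ℝ, 0 < ϱ ∧ ϱ < 1 / ((m : ℝ) + 1) ∧
    ∃ x : Fin (n + 1) → unitInterval, IsTreeStar f ϱ x

lemma isOpen_setOf_isTreeStar (ϱ : ℝ) {n : ℕ} (x : Fin (n + 1) → unitInterval) :
    IsOpen {f : C(unitInterval, ℝ) | IsTreeStar f ϱ x} := by
  simp only [IsTreeStar, Set.ofPred_and, Set.ofPred_forall]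
  refine .inter (isOpen_iInter_of_finite fun i ↦ isOpen_iInter_of_finite fun j ↦
    isOpen_iInter_of_finite fun _ ↦ .inter ?_ ?_) (isOpen_iInter_of_finite fun i ↦ .inter ?_ ?_)
  all_goals
    first
    | exact isOpen_lt continuous_const (continuous_treeDist _ _)
    | exact isOpen_lt (continuous_treeDist _ _) continuous_const

/-- Having small stars is a `Gδ` condition on the path. -/
lemma measurableSet_setOf_hasSmallStars (n : ℕ) :
    MeasurableSet[borel C(unitInterval, ℝ)] {f | HasSmallStars n f} := by
  borelize C(unitInterval, ℝ)
  have h : {f | HasSmallStars n f} = ⋂ m : ℕ, ⋃ (ϱ : ℝ) (_ : 0 < ϱ ∧ ϱ < 1 / ((m : ℝ) + 1))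
      (x : Fin (n + 1) → unitInterval), {f | IsTreeStar f ϱ x} := by
    ext f
    simp [HasSmallStars, and_assoc]
  rw [h]
  exact .iInter fun m ↦ (isOpen_iUnion fun ϱ ↦ isOpen_iUnion fun _ ↦ isOpen_iUnion fun x ↦
    isOpen_setOf_isTreeStar ϱ x).measurableSet

lemma IsTreeStar.isApproxStar {f : C(unitInterval, ℝ)} {ϱ : ℝ} (hϱ : 0 < ϱ) {n : ℕ}
    {x : Fin (n + 1) → unitInterval} (h : IsTreeStar f ϱ x) :
    IsApproxStar (9 / 4) (1 / 4) (toTree f ∘ x) := by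
  refine ⟨by norm_num, by norm_num, by norm_num, by norm_num, ϱ, hϱ, fun i j hij ↦ ?_,
    fun i ↦ ?_⟩
  · simp only [Function.comp_apply, dist_toTree]
    constructor <;> linarith [(h.1 i j hij).1, (h.1 i j hij).2]
  · simp only [Function.comp_apply, dist_toTree]
    constructor <;> linarith [(h.2 i).1, (h.2 i).2]

/-! ### Consequences of small stars -/

lemma HasSmallStars.infinite_of_pos {n : ℕ} (hn : 0 < n) {f : C(unitInterval, ℝ)}
    (h : HasSmallStars n f) :
    {x : Fin (n + 1) → ContinuumTree f | IsApproxStar (9 / 4) (1 / 4) x}.Infinite := by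
  intro hfin
  obtain ⟨ϱ₀, h₀, -, x₀, hx₀⟩ := h 0
  -- Among finitely many stars, one minimizes the distance from the centre to the first leaf; a
  -- smaller star contradicts this.
  obtain ⟨z, hz, hmin⟩ := Set.exists_min_image _
    (fun x : Fin (n + 1) → ContinuumTree f ↦ dist (x 0) (x (Fin.succ ⟨0, hn⟩))) hfin
    ⟨_, hx₀.isApproxStar h₀⟩
  have hpos : 0 < dist (z 0) (z (Fin.succ ⟨0, hn⟩)) := by
    obtain ⟨-, -, -, -, ϱ, hϱ, -, h2⟩ := hz
    exact hϱ.trans_le (h2 _).1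
  obtain ⟨m, hm⟩ := exists_nat_one_div_lt (half_pos hpos)
  obtain ⟨ϱ, hϱ, hϱm, x, hx⟩ := h m
  have h1 := hmin _ (hx.isApproxStar hϱ)
  simp only [Function.comp_apply, dist_toTree] at h1
  linarith [(hx.2 ⟨0, hn⟩).2]

lemma infinite_setOf_isApproxStar {f : C(unitInterval, ℝ)} (h : ∀ n, HasSmallStars n f) (n : ℕ) :
    {x : Fin (n + 1) → ContinuumTree f | IsApproxStar (9 / 4) (1 / 4) x}.Infinite := by
  rcases Nat.eq_zero_or_pos n with rfl | hn
  · -- Every single point is a star without leaves, and the tree is infinite.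
    have : Infinite (ContinuumTree f) := by
      by_contra hfin
      rw [not_infinite_iff_finite] at hfin
      exact (h 1).infinite_of_pos one_pos (Set.toFinite _)
    convert! Set.infinite_univ (α := Fin 1 → ContinuumTree f)
    refine Set.eq_univ_of_forall fun x ↦ ⟨by norm_num, by norm_num, by norm_num, by norm_num, 1,
      one_pos, fun i ↦ i.elim0, fun i ↦ i.elim0⟩
  · exact (h n).infinite_of_pos hn

lemma isStarry_of_hasSmallStars {f : C(unitInterval, ℝ)} (h : ∀ n, HasSmallStars n f) :
    IsStarry (ContinuumTree f) :=
  ⟨9 / 4, 1 / 4, by norm_num, by norm_num, by norm_num, fun n ↦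
    ⟨9 / 4, le_rfl, (infinite_setOf_isApproxStar h n).nonempty⟩⟩

/-- A set containing `n` points at mutual distances greater than `r` needs at least `n` sets of
diameter at most `r` to be covered. -/
lemma le_coverNumber {X : Type*} [MetricSpace X] {S : Set X} {r : ℝ} (hr : 0 ≤ r) {n : ℕ}
    {y : Fin n → X} (hy : ∀ i, y i ∈ S) (hsep : ∀ i j, i ≠ j → r < dist (y i) (y j)) :
    (n : ℕ∞) ≤ coverNumber S r := by
  refine le_iInf₂ fun 𝒰 h𝒰 ↦ ?_
  choose U hU hyU using fun i ↦ Set.mem_sUnion.1 (h𝒰.1 (hy i))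
  have hinj : Function.Injective U := by
    intro i j hij
    by_contra hne
    have h1 : edist (y i) (y j) ≤ ENNReal.ofReal r :=
      (Metric.edist_le_ediam_of_mem (hyU i) (hij ▸ hyU j)).trans (h𝒰.2 _ (hU i))
    rw [edist_dist, ENNReal.ofReal_le_ofReal_iff hr] at h1
    exact (hsep i j hne).not_ge h1
  calc (n : ℕ∞) = (Set.range U).encard := by
        rw [← Set.image_univ, hinj.encard_image, Set.encard_univ]; simp
    _ ≤ 𝒰.encard := Set.encard_le_encard (Set.range_subset_iff.2 hU)

lemma assouadDim_eq_top_of_hasSmallStars {f : C(unitInterval, ℝ)}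
    (h : ∀ n, HasSmallStars n f) : assouadDim (ContinuumTree f) = ⊤ := by
  rw [assouadDim, iInf₂_eq_top]
  rintro α ⟨C, hC, hcov⟩
  exfalso
  obtain ⟨n, hn⟩ := exists_nat_gt (C * (5 / 4) ^ (α : ℝ))
  obtain ⟨ϱ, hϱ, hϱ1, x, hx⟩ := h n 1
  norm_num at hϱ1
  have h1 := hcov ϱ (5 / 4 * ϱ) hϱ (by linarith) (by linarith) (toTree f (x 0))
  have h2 : (n : ℕ∞) ≤ coverNumber (Metric.closedBall (toTree f (x 0)) (5 / 4 * ϱ)) ϱ := by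
    refine le_coverNumber hϱ.le (y := fun i ↦ toTree f (x i.succ)) (fun i ↦ ?_) fun i j hij ↦ ?_
    · rw [Metric.mem_closedBall, dist_comm, dist_toTree]
      exact (hx.2 i).2.le
    · rw [dist_toTree]
      linarith [(hx.1 i j hij).1]
  have h3 : (n : ℝ≥0∞) ≤ ENNReal.ofReal (C * (5 / 4) ^ (α : ℝ)) := by
    have : ((n : ℕ∞) : ℝ≥0∞) ≤ _ := (ENat.toENNReal_le.2 h2).trans h1
    rwa [mul_div_assoc, div_self hϱ.ne', mul_one, ENat.toENNReal_coe] at this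
  rw [← ENNReal.ofReal_natCast, ENNReal.ofReal_le_ofReal_iff (by positivity)] at h3
  linarith

/-- In a doubling space, a ball of radius `r` is covered by `K ^ k` balls of radius
`r / 2 ^ k`. -/
lemma exists_cover_pow {Y : Type*} [MetricSpace Y] {K : ℕ}
    (hK : ∀ (x : Y) (r : ℝ), 0 < r →
      ∃ t : Finset Y, t.card ≤ K ∧ Metric.closedBall x r ⊆ ⋃ y ∈ t, Metric.closedBall y (r / 2))
    (x : Y) {r : ℝ} (hr : 0 < r) (k : ℕ) :
    ∃ t : Finset Y, t.card ≤ K ^ k ∧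
      Metric.closedBall x r ⊆ ⋃ y ∈ t, Metric.closedBall y (r / 2 ^ k) := by
  classical
  induction k with
  | zero => exact ⟨{x}, by simp⟩
  | succ k ih =>
    obtain ⟨t, htc, ht⟩ := ih
    choose T hTc hT using fun y ↦ hK y (r / 2 ^ k) (by positivity)
    refine ⟨t.biUnion T, ?_, fun z hz ↦ ?_⟩
    · exact (Finset.card_biUnion_le_card_mul t T K fun y _ ↦ hTc y).trans
        ((Nat.mul_le_mul_right K htc).trans_eq (pow_succ K k).symm)
    · obtain ⟨y, hy, hzy⟩ := Set.mem_iUnion₂.1 (ht hz)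
      obtain ⟨y', hy', hzy'⟩ := Set.mem_iUnion₂.1 (hT y hzy)
      refine Set.mem_iUnion₂.2 ⟨y', Finset.mem_biUnion.2 ⟨y, hy, hy'⟩, ?_⟩
      rwa [pow_succ, ← div_div]

/-- A quasisymmetric map carries the leaves of a star to points at comparable distances from each
other and from the image of the centre, with constants that do not depend on the number of leaves;
a doubling space does not contain such configurations with arbitrarily many points. -/
lemma not_isQuasisymmetricEmbedding_of_hasSmallStars {f : C(unitInterval, ℝ)}
    (h : ∀ n, HasSmallStars n f) {Y : Type*} [MetricSpace Y] (hY : IsDoubling Y)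
    (φ : ContinuumTree f → Y) : ¬ IsQuasisymmetricEmbedding φ := by
  rintro ⟨hφ, Ψ, hmono, hpos, hqs⟩
  obtain ⟨K, hK⟩ := hY
  have ha : 0 < Ψ 1 := hpos 1 one_pos
  have hb : 0 < Ψ (5 / 4) := hpos _ (by norm_num)
  obtain ⟨k, hk⟩ := pow_unbounded_of_one_lt (2 * Ψ 1 * Ψ (5 / 4)) (one_lt_two (α := ℝ))
  obtain ⟨ϱ, hϱ, -, x, hx⟩ := h (K ^ k + 1) 0
  set y : Fin (K ^ k + 1) → ContinuumTree f := fun i ↦ toTree f (x i.succ)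
  set o : ContinuumTree f := toTree f (x 0)
  have hoy : ∀ i, ϱ < dist o (y i) ∧ dist o (y i) < 5 / 4 * ϱ := fun i ↦ by
    simpa only [o, y, dist_toTree] using hx.2 i
  have hyy : ∀ i j, i ≠ j → 2 * ϱ < dist (y i) (y j) := fun i j hij ↦ by
    simpa only [y, dist_toTree] using (hx.1 i j hij).1
  have hoy' : ∀ i, o ≠ y i := fun i ↦ dist_pos.1 (hϱ.trans (hoy i).1)
  have hyy' : ∀ i j, i ≠ j → y i ≠ y j := fun i j hij ↦
    dist_pos.1 (by linarith [hyy i j hij])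
  have hφo : ∀ i, 0 < dist (φ o) (φ (y i)) := fun i ↦ dist_pos.2 (hφ.injective.ne (hoy' i))
  -- The leaf whose image is farthest from the image of the centre.
  obtain ⟨i₀, hi₀⟩ := Finite.exists_max fun i ↦ dist (φ o) (φ (y i))
  set D := dist (φ o) (φ (y i₀))
  have hD : 0 < D := hφo i₀
  have hsep : ∀ i j, i ≠ j → D / (Ψ 1 * Ψ (5 / 4)) ≤ dist (φ (y i)) (φ (y j)) := by
    intro i j hij
    have h1 : D ≤ Ψ (5 / 4) * dist (φ o) (φ (y i)) := by
      rcases eq_or_ne i₀ i with rfl | hne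
      · have h2 := hqs o (y i₀) (y j) (hoy' _) (hyy' _ _ hij) (hoy' _)
        have h4 : Ψ (dist o (y i₀) / dist o (y j)) ≤ Ψ (5 / 4) := by
          refine hmono (Set.mem_Ioi.2 (div_pos (by linarith [hoy i₀]) (by linarith [hoy j])))
            (Set.mem_Ioi.2 (by norm_num)) ?_
          rw [div_le_iff₀ (by linarith [hoy j])]
          linarith [hoy i₀, hoy j]
        have h6 : 1 ≤ dist (φ o) (φ (y i₀)) / dist (φ o) (φ (y j)) := by
          rw [one_le_div (hφo j)]
          exact hi₀ j
        nlinarith [h6.trans (h2.trans h4)]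
      · have h2 := hqs o (y i₀) (y i) (hoy' _) (hyy' _ _ hne) (hoy' _)
        have h4 : Ψ (dist o (y i₀) / dist o (y i)) ≤ Ψ (5 / 4) := by
          refine hmono (Set.mem_Ioi.2 (div_pos (by linarith [hoy i₀]) (by linarith [hoy i])))
            (Set.mem_Ioi.2 (by norm_num)) ?_
          rw [div_le_iff₀ (by linarith [hoy i])]
          linarith [hoy i₀, hoy i]
        exact (div_le_iff₀ (hφo i)).1 (h2.trans h4)
    have hp : 0 < dist (y i) (y j) := by linarith [hyy i j hij]
    have h2 := hqs (y i) o (y j) (hoy' i).symm (hoy' j) (hyy' _ _ hij)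
    have h3 : Ψ (dist (y i) o / dist (y i) (y j)) ≤ Ψ 1 := by
      refine hmono (Set.mem_Ioi.2 (div_pos (by rw [dist_comm]; linarith [hoy i]) hp))
        (Set.mem_Ioi.2 one_pos) ?_
      rw [div_le_one hp, dist_comm]
      linarith [hyy i j hij, hoy i]
    have h4 : dist (φ o) (φ (y i)) ≤ Ψ 1 * dist (φ (y i)) (φ (y j)) := by
      rw [dist_comm (φ o)]
      exact (div_le_iff₀ (dist_pos.2 (hφ.injective.ne (hyy' _ _ hij)))).1 (h2.trans h3)
    rw [div_le_iff₀ (mul_pos ha hb)]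
    nlinarith
  obtain ⟨t, htc, ht⟩ := exists_cover_pow hK (φ o) hD k
  choose c hc hyc using fun i ↦ Set.mem_iUnion₂.1
    (ht (show φ (y i) ∈ Metric.closedBall (φ o) D by
      rw [Metric.mem_closedBall, dist_comm]; exact hi₀ i))
  obtain ⟨i, -, j, -, hij, hcij⟩ := Finset.exists_ne_map_eq_of_card_lt_of_maps_to
    (s := Finset.univ) (t := t) (by simpa using Nat.lt_succ_of_le htc) (f := c) fun i _ ↦ hc i
  have h1 := hsep i j hij
  have h2 : dist (φ (y i)) (φ (y j)) ≤ D / 2 ^ k + D / 2 ^ k :=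
    (dist_triangle_right _ _ (c i)).trans (add_le_add (hyc i) (hcij ▸ hyc j))
  rw [div_le_iff₀ (mul_pos ha hb)] at h1
  have h3 : D * 2 ^ k ≤ 2 * D * (Ψ 1 * Ψ (5 / 4)) := by
    have h5 : D / 2 ^ k * 2 ^ k = D := div_mul_cancel₀ _ (by positivity)
    nlinarith [mul_le_mul_of_nonneg_right h2 (mul_pos ha hb).le,
      pow_pos (two_pos (α := ℝ)) k]
  nlinarith

/-! ### Paths with oscillations of equal height -/

/-- A continuous path oscillating `n` times between the levels `0` and `1`. -/
noncomputable def wave (n : ℕ) (s : ℝ) : ℝ := (1 - Real.cos (2 * Real.pi * n * s)) / 2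

lemma continuous_wave (n : ℕ) : Continuous (wave n) := by
  unfold wave; fun_prop

lemma wave_nonneg (n : ℕ) (s : ℝ) : 0 ≤ wave n s := by
  unfold wave; linarith [Real.cos_le_one (2 * Real.pi * n * s)]

lemma wave_zero (n : ℕ) : wave n 0 = 0 := by simp [wave]

lemma wave_valley {n : ℕ} (hn : 0 < n) (i : ℕ) : wave n (i / n) = 0 := by
  have hn' : (n : ℝ) ≠ 0 := by positivity
  have h : 2 * Real.pi * n * (i / n) = i * (2 * Real.pi) := by field_simp
  rw [wave, h, Real.cos_nat_mul_two_pi]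
  norm_num

lemma wave_peak {n : ℕ} (hn : 0 < n) (i : ℕ) : wave n ((i + 1 / 2) / n) = 1 := by
  have hn' : (n : ℝ) ≠ 0 := by positivity
  have h : 2 * Real.pi * n * ((i + 1 / 2) / n) = i * (2 * Real.pi) + Real.pi := by field_simp
  rw [wave, h, Real.cos_nat_mul_two_pi_add_pi]
  norm_num

/-- Monotone changes of parameter do not affect the tree distance. -/
lemma treeDist_comp {f f' : C(unitInterval, ℝ)} {p : unitInterval → unitInterval}
    (hp : Continuous p) (hmono : Monotone p) (hf : ∀ s, f' s = f (p s)) (x y : unitInterval) :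
    treeDist f (p x) (p y) = treeDist f' x y := by
  have himg : p '' Set.uIcc x y = Set.uIcc (p x) (p y) :=
    Set.Subset.antisymm hmono.image_uIcc_subset (intermediate_value_uIcc hp.continuousOn)
  have h : f '' Set.uIcc (p x) (p y) = f' '' Set.uIcc x y := by
    rw [← himg, Set.image_image]
    exact Set.image_congr fun s _ ↦ (hf s).symm
  rw [treeDist, treeDist, h, hf, hf]

/-- A path that is uniformly close to `ϱ` times a wave with `n` oscillations codes a star: the
starting point is its centre and the peaks are its leaves. The distances are within `ϱ / 16` of `ϱ`
and `2 * ϱ`; the factor `93 / 100` makes them fit strictly into the windows of `IsTreeStar`. -/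
lemma exists_isTreeStar_of_near_wave {n : ℕ} {f : C(unitInterval, ℝ)} {ϱ c : ℝ} (hϱ : 0 < ϱ)
    (hf : ∀ s : unitInterval, |f s - c - ϱ * wave n s| ≤ ϱ / 64) :
    ∃ x : Fin (n + 1) → unitInterval, IsTreeStar f (93 / 100 * ϱ) x := by
  have hmem : ∀ i : Fin n, ((i : ℝ) + 1 / 2) / n ∈ Set.Icc (0 : ℝ) 1 := fun i ↦ by
    have hn : (0 : ℝ) < n := by exact_mod_cast i.pos
    have hi : (i : ℝ) + 1 ≤ n := by exact_mod_cast i.isLt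
    exact ⟨by positivity, by rw [div_le_one hn]; linarith⟩
  have hlow : ∀ x y, c - ϱ / 64 ≤ sInf (f '' Set.uIcc x y) := fun x y ↦ by
    refine le_csInf (Set.nonempty_uIcc.image f) ?_
    rintro _ ⟨t, -, rfl⟩
    nlinarith [abs_le.1 (hf t), wave_nonneg n t]
  have hpeak : ∀ i : Fin n, |f ⟨_, hmem i⟩ - c - ϱ| ≤ ϱ / 64 := fun i ↦ by
    have h := hf ⟨_, hmem i⟩
    rwa [show wave n _ = 1 from wave_peak i.pos i, mul_one] at h
  have hstart : |f 0 - c| ≤ ϱ / 64 := by simpa [wave_zero] using hf 0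
  refine ⟨Fin.cons 0 fun i ↦ ⟨_, hmem i⟩, fun i j hij ↦ ?_, fun i ↦ ?_⟩
  · -- Between two peaks the path returns to the level of the starting point.
    have key : ∀ i j : Fin n, i < j → sInf (f '' Set.uIcc ⟨_, hmem i⟩ ⟨_, hmem j⟩)
        ≤ c + ϱ / 64 := fun i j hij ↦ by
      have hn : (0 : ℝ) < n := by exact_mod_cast i.pos
      have hij' : (i : ℝ) + 1 ≤ j := by exact_mod_cast hij
      have hj : (j : ℝ) + 1 ≤ n := by exact_mod_cast j.isLt
      have ht : ((i + 1 : ℕ) : ℝ) / n ∈ Set.Icc (0 : ℝ) 1 :=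
        ⟨by positivity, by rw [div_le_one hn]; push_cast; linarith⟩
      have h1 : sInf (f '' Set.uIcc ⟨_, hmem i⟩ ⟨_, hmem j⟩) ≤ f ⟨_, ht⟩ := by
        refine sInf_le_of_mem f (Set.Icc_subset_uIcc ⟨Subtype.mk_le_mk.2 ?_,
          Subtype.mk_le_mk.2 ?_⟩)
        all_goals
          refine div_le_div_of_nonneg_right ?_ hn.le
          push_cast
          linarith
      have h2 := hf ⟨_, ht⟩
      rw [wave_valley i.pos] at h2
      linarith [abs_le.1 h2]
    have hupp : sInf (f '' Set.uIcc ⟨_, hmem i⟩ ⟨_, hmem j⟩) ≤ c + ϱ / 64 := by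
      rcases lt_or_gt_of_ne hij with h | h
      · exact key i j h
      · rw [Set.uIcc_comm]
        exact key j i h
    have h1 := hlow ⟨_, hmem i⟩ ⟨_, hmem j⟩
    have h2 := abs_le.1 (hpeak i)
    have h3 := abs_le.1 (hpeak j)
    simp only [Fin.cons_succ, treeDist]
    constructor <;> linarith
  · have h1 := hlow 0 ⟨_, hmem i⟩
    have h2 := abs_le.1 (hpeak i)
    have h3 := abs_le.1 hstart
    have h4 : sInf (f '' Set.uIcc 0 ⟨_, hmem i⟩) ≤ f 0 := sInf_le_of_mem f Set.left_mem_uIcc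
    simp only [Fin.cons_succ, Fin.cons_zero, treeDist]
    constructor <;> linarith

/-- It suffices that the path is close to a wave on some subinterval `[a, a + h]`. -/
lemma exists_isTreeStar_of_near_wave_on {n : ℕ} {f : C(unitInterval, ℝ)} {ϱ c a h : ℝ}
    (hϱ : 0 < ϱ) (ha : 0 ≤ a) (hh : 0 ≤ h) (hah : a + h ≤ 1)
    (hf : ∀ t : unitInterval, ∀ s ∈ Set.Icc (0 : ℝ) 1, (t : ℝ) = a + h * s →
      |f t - c - ϱ * wave n s| ≤ ϱ / 64) :
    ∃ x : Fin (n + 1) → unitInterval, IsTreeStar f (93 / 100 * ϱ) x := by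
  set p : unitInterval → unitInterval := fun s ↦ ⟨a + h * s, by nlinarith [s.2.1, s.2.2],
    by nlinarith [s.2.1, s.2.2]⟩
  have hp : Continuous p := by fun_prop
  have hmono : Monotone p := fun s t hst ↦ Subtype.mk_le_mk.2 (by
    have : (s : ℝ) ≤ t := hst
    nlinarith)
  obtain ⟨x, hx⟩ := exists_isTreeStar_of_near_wave (f := f.comp ⟨p, hp⟩) (n := n) (c := c) hϱ
    fun s ↦ hf (p s) s s.2 rfl
  refine ⟨p ∘ x, fun i j hij ↦ ?_, fun i ↦ ?_⟩
  · simpa only [Function.comp_apply,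
      treeDist_comp hp hmono (f' := f.comp ⟨p, hp⟩) fun _ ↦ rfl] using hx.1 i j hij
  · simpa only [Function.comp_apply,
      treeDist_comp hp hmono (f' := f.comp ⟨p, hp⟩) fun _ ↦ rfl] using hx.2 i

/-! ### Rescaled increments of Brownian motion -/

section BrownianMotion

variable {Ω : Type*} {mΩ : MeasurableSpace Ω} {P : Measure Ω} {X : ℝ≥0 → Ω → ℝ}

/-- The increment of `X` over `[t, t + h]`, with time and space rescaled as for a Brownian
motion. -/
noncomputable def rescaled (X : ℝ≥0 → Ω → ℝ) (t h s : ℝ≥0) (ω : Ω) : ℝ :=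
  (√h)⁻¹ * (X (t + h * s) ω - X t ω)

/-- Rescaled increments over non-overlapping intervals are independent as processes on
`[0, 1]`. -/
lemma iIndepFun_rescaled (hX : IsPreBrownianReal X P) {ι : Type*} {t h : ι → ℝ≥0}
    (hdisj : ∀ i j, i ≠ j → t i + h i ≤ t j ∨ t j + h j ≤ t i) :
    iIndepFun (fun i ω (s : Set.Iic (1 : ℝ≥0)) ↦ rescaled X (t i) (h i) s ω) P := by
  classical
  have := hX.isGaussianProcess.isProbabilityMeasure
  have hL (r : ℝ≥0) : MemLp (X r) 2 P := (hX.isGaussianProcess.hasGaussianLaw_eval r).memLp_two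
  refine IsGaussianProcess.iIndepFun_of_covariance_eq_zero
    (X := fun i (s : Set.Iic (1 : ℝ≥0)) ↦ rescaled X (t i) (h i) s) ?_ (fun i s ↦ ?_) ?_
  · refine hX.isGaussianProcess.of_isGaussianProcess fun p ↦
      ⟨{t p.1, t p.1 + h p.1 * p.2},
        { toFun x := (√(h p.1))⁻¹ * (x ⟨t p.1 + h p.1 * p.2, by simp⟩ - x ⟨t p.1, by simp⟩)
          map_add' x y := by simp; ring
          map_smul' c x := by simp; ring }, fun ω ↦ by simp [rescaled]⟩
  · exact ((hX.aemeasurable _).sub (hX.aemeasurable _)).const_mul _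
  · intro i j hij s s'
    wlog hle : t i + h i ≤ t j generalizing i j s s'
    · rw [covariance_comm]
      exact this j i hij.symm s' s ((hdisj i j hij).resolve_left hle)
    have h1 : t i + h i * s ≤ t j :=
      (add_le_add_right (mul_le_of_le_one_right' s.2) _).trans hle
    have h2 : t i ≤ t j := le_self_add.trans h1
    have h3 : t j ≤ t j + h j * s' := le_self_add
    unfold rescaled
    rw [covariance_const_mul_left, covariance_const_mul_right,
      covariance_fun_sub_fun_sub (hL _) (hL _) (hL _) (hL _)]
    simp only [hX.covariance_fun_eval]
    rw [min_eq_left h1, min_eq_left h2, min_eq_left (h1.trans h3), min_eq_left (h2.trans h3)]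
    simp

/-- By Brownian scaling, rescaled increments have the law of the process itself. -/
lemma measure_rescaled_preimage (hX : IsPreBrownianReal X P) (hm : ∀ t, Measurable (X t))
    (t : ℝ≥0) {h : ℝ≥0} (hh : h ≠ 0) {A : Set (Set.Iic (1 : ℝ≥0) → ℝ)} (hA : MeasurableSet A) :
    P ((fun ω (s : Set.Iic (1 : ℝ≥0)) ↦ rescaled X t h s ω) ⁻¹' A) =
      P ((fun ω (s : Set.Iic (1 : ℝ≥0)) ↦ X s ω) ⁻¹' A) := by
  have := hX.isGaussianProcess.isProbabilityMeasure
  have hY : IsPreBrownianReal (rescaled X t h) P := (hX.shift t).smul hh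
  have hmY : ∀ s, Measurable (rescaled X t h s) := fun s ↦ ((hm _).sub (hm _)).const_mul _
  have hmX' : Measurable fun ω (s : Set.Iic (1 : ℝ≥0)) ↦ X s ω :=
    measurable_pi_lambda _ fun _ ↦ hm _
  have hmY' : Measurable fun ω (s : Set.Iic (1 : ℝ≥0)) ↦ rescaled X t h s ω :=
    measurable_pi_lambda _ fun _ ↦ hmY _
  have hlaw : P.map (fun ω s ↦ rescaled X t h s ω) = P.map (fun ω s ↦ X s ω) :=
    (map_eq_iff_forall_finset_map_restrict_eq (measurable_pi_lambda _ hmY).aemeasurable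
      (measurable_pi_lambda _ hm).aemeasurable).2 fun I ↦ by
        rw [(hY.hasLaw I).map_eq, (hX.hasLaw I).map_eq]
  have hr : Measurable fun (y : ℝ≥0 → ℝ) (s : Set.Iic (1 : ℝ≥0)) ↦ y s :=
    measurable_pi_lambda _ fun _ ↦ measurable_pi_apply _
  have h1 := congrArg (fun μ ↦ μ ((fun (y : ℝ≥0 → ℝ) (s : Set.Iic (1 : ℝ≥0)) ↦ y s) ⁻¹' A)) hlaw
  rwa [Measure.map_apply (measurable_pi_lambda _ hmY) (hr hA),
    Measure.map_apply (measurable_pi_lambda _ hm) (hr hA)] at h1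

/-- Uniform bounds on continuous paths over `[0, 1]` are events of the product `σ`-algebra: a
countable dense set of times decides them. -/
lemma exists_measurableSet_forall_le {Φ : (Set.Iic (1 : ℝ≥0) → ℝ) → Set.Iic (1 : ℝ≥0) → ℝ}
    (hΦ : ∀ s, Measurable fun y ↦ Φ y s) (c : ℝ) :
    ∃ A : Set (Set.Iic (1 : ℝ≥0) → ℝ), MeasurableSet A ∧
      ∀ y, Continuous (Φ y) → (y ∈ A ↔ ∀ s, Φ y s ≤ c) := by
  obtain ⟨D, hDc, hD⟩ := TopologicalSpace.exists_countable_dense (Set.Iic (1 : ℝ≥0))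
  refine ⟨⋂ s ∈ D, {y | Φ y s ≤ c},
    .biInter hDc fun s _ ↦ measurableSet_le (hΦ s) measurable_const, fun y hy ↦ ⟨fun h s ↦ ?_,
      fun h ↦ Set.mem_iInter₂.2 fun s _ ↦ h s⟩⟩
  have hcl : IsClosed {s | Φ y s ≤ c} := isClosed_le hy continuous_const
  have hsub : D ⊆ {s | Φ y s ≤ c} := fun s hs ↦ Set.mem_iInter₂.1 h s hs
  exact hcl.closure_subset_iff.2 hsub (hD s)

/-! ### Brownian motion stays close to a given path with positive probability -/

/-- The Brownian bridge is independent of the endpoint of the Brownian motion. -/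
lemma indepFun_endpoint_bridge (hX : IsPreBrownianReal X P) :
    IndepFun (X 1) (fun ω (s : Set.Iic (1 : ℝ≥0)) ↦ X s ω - (s : ℝ≥0) * X 1 ω) P := by
  classical
  have := hX.isGaussianProcess.isProbabilityMeasure
  have hL (r : ℝ≥0) : MemLp (X r) 2 P := (hX.isGaussianProcess.hasGaussianLaw_eval r).memLp_two
  have h : IndepFun (fun ω (_ : Unit) ↦ X 1 ω)
      (fun ω (s : Set.Iic (1 : ℝ≥0)) ↦ X s ω - (s : ℝ≥0) * X 1 ω) P := by
    refine IsGaussianProcess.indepFun_of_covariance_eq_zero (X := fun _ : Unit ↦ X 1)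
      (Y := fun (s : Set.Iic (1 : ℝ≥0)) ω ↦ X s ω - (s : ℝ≥0) * X 1 ω) ?_
      (fun _ ↦ hX.aemeasurable _)
      (fun s ↦ (hX.aemeasurable _).sub ((hX.aemeasurable _).const_mul _)) fun _ s ↦ ?_
    · refine hX.isGaussianProcess.of_isGaussianProcess ?_
      rintro (- | s)
      · exact ⟨{1},
          { toFun x := x ⟨1, by simp⟩
            map_add' x y := by simp
            map_smul' c x := by simp }, fun ω ↦ by simp⟩
      · exact ⟨{1, (s : ℝ≥0)},
          { toFun x := x ⟨s, by simp⟩ - (s : ℝ≥0) * x ⟨1, by simp⟩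
            map_add' x y := by simp; ring
            map_smul' c x := by simp; ring }, fun ω ↦ by simp⟩
    · rw [covariance_fun_sub_right (hL _) (hL _) ((hL _).const_mul _), covariance_const_mul_right,
        hX.covariance_eval, hX.covariance_eval, min_eq_right s.2]
      simp
  exact h.comp (φ := fun x : Unit → ℝ ↦ x ()) (ψ := id) (measurable_pi_apply _) measurable_id

lemma exists_measure_bridge_bound_pos (hX : IsPreBrownianReal X P)
    (hc : ∀ ω, Continuous fun t ↦ X t ω) :
    ∃ C : ℝ, 0 < P {ω | ∀ s : Set.Iic (1 : ℝ≥0), |X s ω - (s : ℝ≥0) * X 1 ω| ≤ C} := by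
  have := hX.isGaussianProcess.isProbabilityMeasure
  -- Continuous paths are bounded over `[0, 1]`, so some integer bound has positive probability.
  have hU : (⋃ m : ℕ, {ω | ∀ s : Set.Iic (1 : ℝ≥0), |X s ω - (s : ℝ≥0) * X 1 ω| ≤ m}) =
      Set.univ := by
    refine Set.eq_univ_of_forall fun ω ↦ Set.mem_iUnion.2 ?_
    have hcont : Continuous fun s : ℝ≥0 ↦ X s ω - s * X 1 ω := by
      have := hc ω
      fun_prop
    obtain ⟨C, hC⟩ := (isCompact_Icc (a := (0 : ℝ≥0)) (b := 1)).exists_bound_of_continuousOn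
      hcont.continuousOn
    obtain ⟨m, hm⟩ := exists_nat_ge C
    exact ⟨m, fun s ↦ (hC s ⟨zero_le, s.2⟩).trans hm⟩
  obtain ⟨m, hm⟩ := exists_measure_pos_of_not_measure_iUnion_null (μ := P) (by rw [hU]; simp)
  exact ⟨m, hm⟩

/-- With positive probability the endpoint lies in a given interval while the bridge is
bounded. -/
lemma measure_endpoint_bridge_pos (hX : IsPreBrownianReal X P)
    (hc : ∀ ω, Continuous fun t ↦ X t ω) {C : ℝ}
    (hC : 0 < P {ω | ∀ s : Set.Iic (1 : ℝ≥0), |X s ω - (s : ℝ≥0) * X 1 ω| ≤ C})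
    (a : ℝ) {ε : ℝ} (hε : 0 < ε) :
    0 < P {ω | |X 1 ω - a| ≤ ε ∧
      ∀ s : Set.Iic (1 : ℝ≥0), |X s ω - (s : ℝ≥0) * X 1 ω| ≤ C} := by
  obtain ⟨A, hA, hAiff⟩ := exists_measurableSet_forall_le (Φ := fun y s ↦ |y s|)
    (fun s ↦ (measurable_pi_apply s).norm) C
  have hpre : (fun ω (s : Set.Iic (1 : ℝ≥0)) ↦ X s ω - (s : ℝ≥0) * X 1 ω) ⁻¹' A =
      {ω | ∀ s : Set.Iic (1 : ℝ≥0), |X s ω - (s : ℝ≥0) * X 1 ω| ≤ C} := by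
    ext ω
    refine hAiff _ ?_
    have := hc ω
    fun_prop
  have hgauss : 0 < P (X 1 ⁻¹' Metric.closedBall a ε) := by
    have := (gaussianReal_absolutelyContinuous' 0 (one_ne_zero (α := ℝ≥0))).isOpenPosMeasure
    rw [← Measure.map_apply_of_aemeasurable (hX.aemeasurable 1)
      Metric.isClosed_closedBall.measurableSet, (hX.hasLaw_eval 1).map_eq]
    exact Metric.measure_closedBall_pos _ a hε
  have h := (indepFun_endpoint_bridge hX).measure_inter_preimage_eq_mul (Metric.closedBall a ε) A
    Metric.isClosed_closedBall.measurableSet hA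
  rw [hpre] at h
  have hset : {ω | |X 1 ω - a| ≤ ε ∧
      ∀ s : Set.Iic (1 : ℝ≥0), |X s ω - (s : ℝ≥0) * X 1 ω| ≤ C} =
      X 1 ⁻¹' Metric.closedBall a ε ∩
        {ω | ∀ s : Set.Iic (1 : ℝ≥0), |X s ω - (s : ℝ≥0) * X 1 ω| ≤ C} := by
    ext ω
    simp [Real.dist_eq]
  rw [hset, h]
  exact ENNReal.mul_pos hgauss.ne' hC.ne'

lemma exists_grid_decomposition {N : ℕ} (hN : 0 < N) {s : ℝ≥0} (hs : s ≤ 1) :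
    ∃ j < N, ∃ u : ℝ≥0, u ≤ 1 ∧ s = j * (N : ℝ≥0)⁻¹ + (N : ℝ≥0)⁻¹ * u := by
  have hN' : (N : ℝ≥0) ≠ 0 := by positivity
  rcases hs.eq_or_lt with rfl | hs
  · refine ⟨N - 1, by omega, 1, le_rfl, ?_⟩
    have h : ((N - 1 : ℕ) : ℝ≥0) + 1 = N := by exact_mod_cast Nat.sub_add_cancel hN
    rw [mul_comm _ (N : ℝ≥0)⁻¹, ← mul_add, h, inv_mul_cancel₀ hN']
  · have hfl : (⌊s * N⌋₊ : ℝ≥0) ≤ s * N := Nat.floor_le zero_le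
    refine ⟨⌊s * N⌋₊, ?_, s * N - ⌊s * N⌋₊, ?_, ?_⟩
    · rw [Nat.floor_lt zero_le]
      exact mul_lt_of_lt_one_left (by positivity) hs
    · rw [tsub_le_iff_left]
      exact (Nat.lt_floor_add_one _).le
    · rw [mul_comm _ (N : ℝ≥0)⁻¹, ← mul_add, add_tsub_cancel_of_le hfl, mul_comm s,
        inv_mul_cancel_left₀ hN']

/-- A path whose increments over a grid are close to those of `g`, and whose bridges between the
grid points are small, is uniformly close to `g`. -/
lemma near_of_near_on_grid {w : ℝ≥0 → ℝ} (hw : w 0 = 0) {g : ℝ → ℝ} (hg : g 0 = 0) {ε : ℝ}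
    (hε : 0 < ε) {N : ℕ} (hN : 0 < N)
    (hmod : ∀ j < N, ∀ u : ℝ≥0, u ≤ 1 →
      |g (j * (N : ℝ)⁻¹ + (N : ℝ)⁻¹ * u) - g (j * (N : ℝ)⁻¹)| ≤ ε / 8)
    (hinc : ∀ j < N, |w (j * (N : ℝ≥0)⁻¹ + (N : ℝ≥0)⁻¹ * 1) - w (j * (N : ℝ≥0)⁻¹) -
      (g (j * (N : ℝ)⁻¹ + (N : ℝ)⁻¹ * 1) - g (j * (N : ℝ)⁻¹))| ≤ ε / 4 / N)
    (hbr : ∀ j < N, ∀ u : ℝ≥0, u ≤ 1 →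
      |w (j * (N : ℝ≥0)⁻¹ + (N : ℝ≥0)⁻¹ * u) - w (j * (N : ℝ≥0)⁻¹) -
        u * (w (j * (N : ℝ≥0)⁻¹ + (N : ℝ≥0)⁻¹ * 1) - w (j * (N : ℝ≥0)⁻¹))| ≤ ε / 4)
    {s : ℝ≥0} (hs : s ≤ 1) : |w s - g s| ≤ ε := by
  have hN1 : (1 : ℝ) ≤ N := by exact_mod_cast hN
  have hgrid : ∀ j ≤ N, |w (j * (N : ℝ≥0)⁻¹) - g (j * (N : ℝ)⁻¹)| ≤ j * (ε / 4 / N) := by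
    intro j
    induction j with
    | zero => simp [hw, hg]
    | succ j ih =>
      intro hj
      have h1 := abs_le.1 (ih (by omega))
      have h2 := abs_le.1 (hinc j (by omega))
      have h3 : ((j + 1 : ℕ) : ℝ≥0) * (N : ℝ≥0)⁻¹ = j * (N : ℝ≥0)⁻¹ + (N : ℝ≥0)⁻¹ * 1 := by
        push_cast; ring
      have h4 : ((j + 1 : ℕ) : ℝ) * (N : ℝ)⁻¹ = j * (N : ℝ)⁻¹ + (N : ℝ)⁻¹ * 1 := by
        push_cast; ring
      rw [h3, h4, abs_le]
      push_cast
      constructor <;> linarith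
  obtain ⟨j, hj, u, hu, rfl⟩ := exists_grid_decomposition hN hs
  have h1 := hgrid j hj.le
  have h2 : (j : ℝ) * (ε / 4 / N) ≤ ε / 4 := by
    rw [mul_div_assoc', div_le_iff₀ (by linarith)]
    have : (j : ℝ) ≤ N := by exact_mod_cast hj.le
    nlinarith
  have h3 := abs_le.1 (hbr j hj u hu)
  have h4 := abs_le.1 (hinc j hj)
  have h5 := abs_le.1 (hmod j hj u hu)
  have h6 := abs_le.1 (hmod j hj 1 le_rfl)
  have h7 : ε / 4 / N ≤ ε / 4 := div_le_self (by linarith) hN1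
  have h8 : |u * (w (j * (N : ℝ≥0)⁻¹ + (N : ℝ≥0)⁻¹ * 1) - w (j * (N : ℝ≥0)⁻¹))| ≤
      1 * (3 * ε / 8) := by
    rw [abs_mul]
    refine mul_le_mul ?_ (abs_le.2 ⟨?_, ?_⟩) (abs_nonneg _) zero_le_one
    · rw [NNReal.abs_eq]
      exact_mod_cast hu
    all_goals
      simp only [NNReal.coe_one] at h6
      linarith
  have h9 := abs_le.1 h8
  have h10 := abs_le.1 (h1.trans h2)
  push_cast
  rw [abs_le]
  constructor <;> linarith

/-- Brownian motion stays close to any given continuous path over `[0, 1]` with positive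
probability. -/
lemma measure_near_pos (hX : IsPreBrownianReal X P) (hm : ∀ t, Measurable (X t))
    (hc : ∀ ω, Continuous fun t ↦ X t ω) {g : ℝ → ℝ} (hg : Continuous g) (hg0 : g 0 = 0)
    {ε : ℝ} (hε : 0 < ε) :
    0 < P {ω | ∀ s : Set.Iic (1 : ℝ≥0), |X s ω - g (s : ℝ≥0)| ≤ ε} := by
  have := hX.isGaussianProcess.isProbabilityMeasure
  obtain ⟨C, hC⟩ := exists_measure_bridge_bound_pos hX hc
  -- The grid is so fine that bridges over its cells, of size `C / √N`, are small, and that `g`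
  -- hardly varies over them.
  obtain ⟨N, hN, hNC, hmod⟩ : ∃ N : ℕ, 0 < N ∧ C ≤ √N * (ε / 4) ∧ ∀ j < N, ∀ u : ℝ≥0, u ≤ 1 →
      |g (j * (N : ℝ)⁻¹ + (N : ℝ)⁻¹ * u) - g (j * (N : ℝ)⁻¹)| ≤ ε / 8 := by
    obtain ⟨δ, hδ, hgδ⟩ := Metric.uniformContinuousOn_iff.1
      ((isCompact_Icc (a := (0 : ℝ)) (b := 1)).uniformContinuousOn_of_continuous hg.continuousOn)
      (ε / 8) (by positivity)
    obtain ⟨N, hN⟩ := exists_nat_gt (max (max 1 δ⁻¹) ((C / (ε / 4)) ^ 2))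
    have hN1 : (1 : ℝ) < N := ((le_max_left _ _).trans (le_max_left _ _)).trans_lt hN
    have hN2 : δ⁻¹ < N := ((le_max_right _ _).trans (le_max_left _ _)).trans_lt hN
    have hN3 : (C / (ε / 4)) ^ 2 < N := (le_max_right _ _).trans_lt hN
    refine ⟨N, by exact_mod_cast zero_lt_one.trans hN1, ?_, fun j hj u hu ↦ ?_⟩
    · rw [← div_le_iff₀ (by positivity)]
      exact Real.le_sqrt_of_sq_le hN3.le
    · have hj' : (j : ℝ) + 1 ≤ N := by exact_mod_cast hj
      have hu' : (u : ℝ) ≤ 1 := by exact_mod_cast hu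
      have hNi : (0 : ℝ) < (N : ℝ)⁻¹ := by positivity
      have hNN : (N : ℝ) * (N : ℝ)⁻¹ = 1 := mul_inv_cancel₀ (by positivity)
      have hu0 : (0 : ℝ) ≤ u := u.2
      refine (Real.dist_eq _ _ ▸ (hgδ _ ⟨by positivity, ?_⟩ _ ⟨by positivity, ?_⟩ ?_)).le
      · nlinarith
      · nlinarith
      · rw [Real.dist_eq, add_sub_cancel_left, abs_of_nonneg (by positivity)]
        calc (N : ℝ)⁻¹ * u ≤ (N : ℝ)⁻¹ := mul_le_of_le_one_right hNi.le hu'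
          _ < δ := inv_lt_of_inv_lt₀ hδ hN2
  have hN0 : (0 : ℝ) < N := by exact_mod_cast hN
  have hsq : 0 < √(N : ℝ) := Real.sqrt_pos.2 hN0
  set h : ℝ≥0 := (N : ℝ≥0)⁻¹ with hh
  have hh0 : h ≠ 0 := inv_ne_zero (by positivity)
  have hsqh : (√(h : ℝ))⁻¹ = √N := by simp [hh]
  obtain ⟨A, hA, hAiff⟩ := exists_measurableSet_forall_le
    (Φ := fun y s ↦ |y s - (s : ℝ≥0) * y ⟨1, Set.mem_Iic.2 le_rfl⟩|)
    (fun s ↦ ((measurable_pi_apply s).sub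
      ((measurable_pi_apply (⟨1, Set.mem_Iic.2 le_rfl⟩ : Set.Iic (1 : ℝ≥0))).const_mul _)).norm) C
  set G : ℕ → ℝ := fun j ↦ g (j * (N : ℝ)⁻¹ + (N : ℝ)⁻¹ * 1) - g (j * (N : ℝ)⁻¹)
  -- Over each cell, the rescaled path has nearly the increment of `√N * g` and a bounded bridge.
  set S : ℕ → Set (Set.Iic (1 : ℝ≥0) → ℝ) := fun j ↦
    {y | |y ⟨1, Set.mem_Iic.2 le_rfl⟩ - √N * G j| ≤ √N * (ε / 4 / N)} ∩ A
  have hS : ∀ j, MeasurableSet (S j) := fun j ↦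
    (measurableSet_le ((measurable_pi_apply _).sub_const _).norm measurable_const).inter hA
  have hSpos : ∀ j : ℕ,
      P ((fun ω (s : Set.Iic (1 : ℝ≥0)) ↦ rescaled X (j * h) h s ω) ⁻¹' S j) ≠ 0 := fun j ↦ by
    rw [measure_rescaled_preimage hX hm _ hh0 (hS j)]
    refine ((measure_endpoint_bridge_pos hX hc hC (√N * G j)
      (ε := √N * (ε / 4 / N)) (by positivity)).trans_le (measure_mono ?_)).ne'
    intro ω hω
    refine ⟨hω.1, (hAiff _ ?_).2 hω.2⟩
    have := hc ω
    fun_prop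
  have hind := iIndepFun_rescaled hX (ι := ℕ) (t := fun j ↦ j * h) (h := fun _ ↦ h)
    fun i j hij ↦ by
      have key : ∀ i j : ℕ, i < j → (i : ℝ≥0) * h + h ≤ j * h := fun i j hij ↦ by
        rw [← add_one_mul]
        exact mul_le_mul_left (by exact_mod_cast hij) h
      rcases lt_or_gt_of_ne hij with h | h
      · exact .inl (key i j h)
      · exact .inr (key j i h)
  have hprod := hind.measure_inter_preimage_eq_mul (Finset.range N) (sets := S) fun j _ ↦ hS j
  have hpos : 0 < P (⋂ j ∈ Finset.range N,
      (fun ω (s : Set.Iic (1 : ℝ≥0)) ↦ rescaled X (j * h) h s ω) ⁻¹' S j) := by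
    rw [hprod, pos_iff_ne_zero, Finset.prod_ne_zero_iff]
    exact fun j _ ↦ hSpos j
  refine hpos.trans_le (measure_mono_ae ?_)
  filter_upwards [hX.eval_zero_ae_eq_zero] with ω h0 hω s
  have hω' : ∀ j < N, (fun s : Set.Iic (1 : ℝ≥0) ↦ rescaled X (j * h) h s ω) ∈ S j := fun j hj ↦
    Set.mem_iInter₂.1 hω j (Finset.mem_range.2 hj)
  refine near_of_near_on_grid (w := fun t ↦ X t ω) h0 hg0 hε hN hmod (fun j hj ↦ ?_)
    (fun j hj u hu ↦ ?_) s.2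
  · have h1 := (hω' j hj).1
    simp only [rescaled, hsqh, Set.mem_ofPred_eq] at h1
    rwa [← mul_sub, abs_mul, abs_of_pos hsq, mul_le_mul_iff_right₀ hsq] at h1
  · have h1 := (hAiff _ ?_).1 (hω' j hj).2 ⟨u, hu⟩
    · simp only [rescaled, hsqh] at h1
      have h2 := h1.trans hNC
      rwa [mul_left_comm, ← mul_sub, abs_mul, abs_of_pos hsq, mul_le_mul_iff_right₀ hsq] at h2
    · have := hc ω
      unfold rescaled
      fun_prop

/-- Over disjoint intervals, Brownian motion almost surely follows a given continuous path, after
rescaling, infinitely often. -/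
lemma ae_frequently_near (hX : IsPreBrownianReal X P) (hm : ∀ t, Measurable (X t))
    (hc : ∀ ω, Continuous fun t ↦ X t ω) {g : ℝ → ℝ} (hg : Continuous g) (hg0 : g 0 = 0)
    {ε : ℝ} (hε : 0 < ε) {t h : ℕ → ℝ≥0} (hh : ∀ k, h k ≠ 0)
    (hdisj : ∀ i j, i ≠ j → t i + h i ≤ t j ∨ t j + h j ≤ t i) :
    ∀ᵐ ω ∂P, ∃ᶠ k in Filter.atTop, ∀ s : ℝ≥0, s ≤ 1 →
      |rescaled X (t k) (h k) s ω - g s| ≤ ε := by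
  have := hX.isGaussianProcess.isProbabilityMeasure
  obtain ⟨A, hA, hAiff⟩ := exists_measurableSet_forall_le
    (Φ := fun y s ↦ |y s - g (s : ℝ≥0)|)
    (fun s ↦ ((measurable_pi_apply s).sub_const _).norm) ε
  set E : ℕ → Set Ω := fun k ↦
    (fun ω (s : Set.Iic (1 : ℝ≥0)) ↦ rescaled X (t k) (h k) s ω) ⁻¹' A
  have hE : ∀ k, MeasurableSet (E k) := fun k ↦
    (measurable_pi_lambda _ fun s ↦ ((hm _).sub (hm _)).const_mul _) hA
  have hind : iIndepSet E P := (iIndepSet_iff_meas_biInter hE).2 fun s ↦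
    (iIndepFun_rescaled hX hdisj).measure_inter_preimage_eq_mul s fun _ _ ↦ hA
  have hPE : ∀ k, P (E k) = P {ω | ∀ s : Set.Iic (1 : ℝ≥0), |X s ω - g (s : ℝ≥0)| ≤ ε} := by
    intro k
    rw [measure_rescaled_preimage hX hm _ (hh k) hA]
    congr 1
    ext ω
    refine hAiff _ ?_
    have := hc ω
    fun_prop
  have hsum : ∑' k, P (E k) = ∞ := by
    simp_rw [hPE]
    exact ENNReal.tsum_const_eq_top_of_ne_zero (measure_near_pos hX hm hc hg hg0 hε).ne'
  have hlim := measure_limsup_eq_one hE hind hsum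
  have hmem : ∀ᵐ ω ∂P, ω ∈ Filter.limsup E Filter.atTop :=
    (mem_ae_iff_prob_eq_one (.measurableSet_limsup hE)).2 hlim
  filter_upwards [hmem] with ω hω
  refine (Filter.mem_limsup_iff_frequently_mem.1 hω).mono fun k hk s hs ↦ ?_
  refine (hAiff _ ?_).1 hk ⟨s, hs⟩
  have := hc ω
  unfold rescaled
  fun_prop

end BrownianMotion

/-! ### A version with regular paths -/

/-- A Brownian motion is indistinguishable from a process all of whose paths are continuous and all
of whose coordinates are measurable. -/
lemma exists_continuous_measurable_version {Ω : Type*} {mΩ : MeasurableSpace Ω} {P : Measure Ω}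
    {W : ℝ≥0 → Ω → ℝ} (hW : IsBrownianReal W P) :
    ∃ X : ℝ≥0 → Ω → ℝ, IsPreBrownianReal X P ∧ (∀ t, Measurable (X t)) ∧
      (∀ ω, Continuous fun t ↦ X t ω) ∧ ∀ᵐ ω ∂P, ∀ t, X t ω = W t ω := by
  classical
  obtain ⟨D, hDc, hD⟩ := TopologicalSpace.exists_countable_dense ℝ≥0
  have : Countable D := hDc
  have hgood : ∀ᵐ ω ∂P, Continuous (fun t ↦ W t ω) ∧
      ∀ q : D, W q ω = (hW.aemeasurable q).mk (W q) ω :=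
    hW.cont.and (ae_all_iff.2 fun q ↦ (hW.aemeasurable q).ae_eq_mk)
  -- Off a measurable null set, paths are continuous and measurable versions agree on a dense set.
  obtain ⟨N, hsub, hN, hN0⟩ := exists_measurable_superset_of_null (ae_iff.1 hgood)
  have hgoodN : ∀ ω ∉ N, Continuous (fun t ↦ W t ω) ∧
      ∀ q : D, W q ω = (hW.aemeasurable q).mk (W q) ω := fun ω hω ↦ by
    by_contra h
    exact hω (hsub h)
  have hcont : ∀ ω, Continuous fun t ↦ if ω ∈ N then 0 else W t ω := fun ω ↦ by
    by_cases h : ω ∈ N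
    · simpa [h] using continuous_const
    · simpa [h] using (hgoodN ω h).1
  have heq : ∀ᵐ ω ∂P, ∀ t, (if ω ∈ N then 0 else W t ω) = W t ω := by
    filter_upwards [measure_eq_zero_iff_ae_notMem.1 hN0] with ω hω t
    simp [hω]
  refine ⟨fun t ω ↦ if ω ∈ N then 0 else W t ω,
    hW.toIsPreBrownianReal.congr fun t ↦ heq.mono fun ω h ↦ (h t).symm, fun t ↦ ?_, hcont, heq⟩
  obtain ⟨q, hq, hqt⟩ := mem_closure_iff_seq_limit.1 (hD t)
  refine measurable_of_tendsto_metrizable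
    (f := fun i ω ↦ if ω ∈ N then 0 else (hW.aemeasurable (q i)).mk (W (q i)) ω) (fun i ↦ ?_)
    (tendsto_pi_nhds.2 fun ω ↦ ?_)
  · exact Measurable.ite hN measurable_const (hW.aemeasurable (q i)).measurable_mk
  · refine (((hcont ω).tendsto t).comp hqt).congr fun i ↦ ?_
    by_cases h : ω ∈ N
    · simp [h]
    · simp [h, (hgoodN ω h).2 ⟨q i, hq i⟩]

/-! ### From the Brownian path to the excursion -/

lemma argminTime_mem (B : ℝ → ℝ) : argminTime B ∈ Set.Icc (0 : ℝ) 1 := by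
  rw [argminTime]
  rcases Set.eq_empty_or_nonempty {t ∈ Set.Icc (0 : ℝ) 1 | IsMinOn B (Set.Icc 0 1) t} with h | h
  · rw [h, Real.sInf_empty]
    simp
  · obtain ⟨t, ht⟩ := id h
    exact ⟨le_csInf h fun s hs ↦ hs.1.1,
      (csInf_le ⟨0, fun s hs ↦ hs.1.1⟩ ht).trans ht.1.2⟩

lemma continuous_cutAtMin {B : ℝ → ℝ} (hB : Continuous B) (h01 : B 0 = B 1) :
    Continuous (cutAtMin B) := by
  refine Continuous.if_le (by fun_prop) (by fun_prop) continuous_id continuous_const ?_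
  rintro t rfl
  rw [sub_add_cancel, show 1 - argminTime B - 1 + argminTime B = 0 by ring, h01]

lemma continuous_bridge {w : ℝ≥0 → ℝ} (hw : Continuous w) : Continuous (bridge w) := by
  unfold bridge
  fun_prop

/-- An interval on one side of the time of the minimum is moved by a translation when the path is
cut there. -/
lemma exists_shift_cutAtMin (B : ℝ → ℝ) {t h : ℝ} (ht : 0 < t) (hh : 0 ≤ h) (hth : t + h ≤ 1)
    (hτ : argminTime B ≤ t ∨ t + h ≤ argminTime B) :
    ∃ a, 0 ≤ a ∧ a + h ≤ 1 ∧ ∀ s ∈ Set.Icc (0 : ℝ) 1,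
      cutAtMin B (a + h * s) = B (t + h * s) - B (argminTime B) := by
  obtain ⟨h0, h1⟩ := argminTime_mem B
  rcases hτ with hτ | hτ
  · refine ⟨t - argminTime B, by linarith, by linarith, fun s hs ↦ ?_⟩
    rw [cutAtMin, if_pos (by nlinarith [hs.2])]
    congr 2
    ring
  · refine ⟨t + 1 - argminTime B, by linarith, by linarith, fun s hs ↦ ?_⟩
    rw [cutAtMin, if_neg (by nlinarith [hs.1])]
    congr 2
    ring

/-- Left endpoints of pairwise disjoint intervals that shrink towards `0`. -/
noncomputable def leftEnd (k : ℕ) : ℝ≥0 := (1 / 2) ^ (k + 1)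

/-- Lengths of pairwise disjoint intervals that shrink towards `0`. -/
noncomputable def width (k : ℕ) : ℝ≥0 := (1 / 2) ^ (k + 2)

lemma coe_leftEnd (k : ℕ) : (leftEnd k : ℝ) = (1 / 2) ^ (k + 1) := by simp [leftEnd]

lemma coe_width (k : ℕ) : (width k : ℝ) = (1 / 2) ^ (k + 2) := by simp [width]

lemma leftEnd_add_width_le {i j : ℕ} (hij : i < j) : leftEnd j + width j ≤ leftEnd i := by
  rw [← NNReal.coe_le_coe, NNReal.coe_add, coe_leftEnd, coe_leftEnd, coe_width]
  calc (1 / 2 : ℝ) ^ (j + 1) + (1 / 2) ^ (j + 2) = (1 / 2) ^ j * (3 / 4) := by ring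
    _ ≤ (1 / 2) ^ (i + 1) * 1 := by
      refine mul_le_mul (pow_le_pow_of_le_one (by norm_num) (by norm_num) hij) (by norm_num)
        (by norm_num) (by positivity)
    _ = _ := mul_one _

lemma leftEnd_add_width_le_one (k : ℕ) : (leftEnd k : ℝ) + width k ≤ 1 := by
  rw [coe_leftEnd, coe_width]
  have h : (1 / 2 : ℝ) ^ k ≤ 1 := pow_le_one₀ (by norm_num) (by norm_num)
  calc (1 / 2 : ℝ) ^ (k + 1) + (1 / 2) ^ (k + 2) = (1 / 2) ^ k * (3 / 4) := by ring
    _ ≤ 1 := by linarith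

lemma tendsto_leftEnd : Filter.Tendsto (fun k ↦ (leftEnd k : ℝ)) Filter.atTop (nhds 0) := by
  simp_rw [coe_leftEnd]
  exact (tendsto_pow_atTop_nhds_zero_of_lt_one (by norm_num) (by norm_num)).comp
    (Filter.tendsto_add_atTop_nat 1)

lemma tendsto_width : Filter.Tendsto (fun k ↦ (width k : ℝ)) Filter.atTop (nhds 0) := by
  simp_rw [coe_width]
  exact (tendsto_pow_atTop_nhds_zero_of_lt_one (by norm_num) (by norm_num)).comp
    (Filter.tendsto_add_atTop_nat 2)

/-- The intervals lie eventually on one side of any given time `τ ≥ 0`. -/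
lemma eventually_leftEnd {τ : ℝ} (hτ : 0 ≤ τ) : ∀ᶠ k in Filter.atTop,
    τ ≤ leftEnd k ∨ (leftEnd k : ℝ) + width k ≤ τ := by
  rcases hτ.eq_or_lt with rfl | hτ
  · exact .of_forall fun k ↦ .inl (leftEnd k).2
  · have h := tendsto_leftEnd.add tendsto_width
    rw [add_zero] at h
    exact (h.eventually_lt_const hτ).mono fun k hk ↦ .inr hk.le

/-- If a path looks like a wave on infinitely many of the shrinking intervals, at the scale of
Brownian motion, then the tree of the excursion built from its bridge has small stars: the linear
drift of the bridge is of smaller order than the oscillations. -/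
lemma hasSmallStars_of_frequently_near_wave {w : ℝ≥0 → ℝ} {n : ℕ}
    (hfreq : ∃ᶠ k in Filter.atTop, ∀ s : ℝ≥0, s ≤ 1 →
      |(√(width k))⁻¹ * (w (leftEnd k + width k * s) - w (leftEnd k)) - wave n s| ≤ 1 / 128)
    {f : C(unitInterval, ℝ)} (hf : ∀ t, f t = cutAtMin (bridge w) t) :
    HasSmallStars n f := by
  intro m
  have hsqrt : Filter.Tendsto (fun k ↦ √(width k)) Filter.atTop (nhds 0) := by
    have h := (Real.continuous_sqrt.tendsto 0).comp tendsto_width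
    rwa [Real.sqrt_zero] at h
  have hsmall : ∀ᶠ k in Filter.atTop, √(width k) < 1 / ((m : ℝ) + 1) :=
    hsqrt.eventually_lt_const (by positivity)
  have hdrift : ∀ᶠ k in Filter.atTop, √(width k) * |w 1| < 1 / 128 :=
    (hsqrt.mul_const |w 1|).eventually_lt_const (by norm_num)
  obtain ⟨k, hk, ⟨hk1, hk2⟩, hk3⟩ := (hfreq.and_eventually ((hsmall.and hdrift).and
    (eventually_leftEnd (argminTime_mem (bridge w)).1))).exists
  have hh : (0 : ℝ) < width k := by rw [coe_width]; positivity
  have ht : (0 : ℝ) < leftEnd k := by rw [coe_leftEnd]; positivity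
  have hϱ : 0 < √(width k : ℝ) := Real.sqrt_pos.2 hh
  obtain ⟨a, ha0, ha1, ha⟩ := exists_shift_cutAtMin (bridge w) ht hh.le
    (leftEnd_add_width_le_one k) hk3
  refine ⟨93 / 100 * √(width k), by positivity, by linarith,
    exists_isTreeStar_of_near_wave_on
      (c := w (leftEnd k) - leftEnd k * w 1 - bridge w (argminTime (bridge w))) hϱ ha0 hh.le ha1
      fun t s hs hts ↦ ?_⟩
  rw [hf, hts, ha s hs, bridge]
  obtain ⟨s, rfl⟩ : ∃ r : ℝ≥0, s = r := ⟨⟨s, hs.1⟩, rfl⟩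
  have hs1 : (s : ℝ) ≤ 1 := hs.2
  have h1 := hk s (by exact_mod_cast hs1)
  have h2 : ((leftEnd k : ℝ) + width k * s).toNNReal = leftEnd k + width k * s := by
    rw [← NNReal.coe_mul, ← NNReal.coe_add, Real.toNNReal_coe]
  have h3 : |w (leftEnd k + width k * s) - w (leftEnd k) - √(width k) * wave n s| ≤
      √(width k) / 128 := by
    have h : w (leftEnd k + width k * s) - w (leftEnd k) - √(width k) * wave n s =
        √(width k) * ((√(width k))⁻¹ * (w (leftEnd k + width k * s) - w (leftEnd k)) -
          wave n s) := by
      rw [mul_sub, mul_inv_cancel_left₀ hϱ.ne']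
    rw [h, abs_mul, abs_of_pos hϱ]
    nlinarith
  have h4 : |(width k : ℝ) * s * w 1| ≤ √(width k) / 128 := by
    rw [abs_mul, abs_of_nonneg (by positivity)]
    calc (width k : ℝ) * s * |w 1| ≤ width k * |w 1| :=
          mul_le_mul_of_nonneg_right (mul_le_of_le_one_right hh.le hs1) (abs_nonneg _)
      _ = √(width k) * (√(width k) * |w 1|) := by
          rw [← mul_assoc, Real.mul_self_sqrt hh.le]
      _ ≤ √(width k) / 128 := by nlinarith
  rw [h2]
  have h3' := abs_le.1 h3
  have h4' := abs_le.1 h4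
  rw [abs_le]
  constructor <;> linarith

/-- The path that defines the Brownian excursion is almost surely continuous, with small stars in
its tree. -/
lemma ae_exists_hasSmallStars_cutAtMin {Ω : Type*} {mΩ : MeasurableSpace Ω} {P : Measure Ω}
    {W : ℝ≥0 → Ω → ℝ} (hW : IsBrownianReal W P) (n : ℕ) :
    ∀ᵐ ω ∂P, ∃ f : C(unitInterval, ℝ), HasSmallStars n f ∧
      ∀ t, f t = cutAtMin (bridge fun s ↦ W s ω) t := by
  obtain ⟨X, hX, hm, hc, hXW⟩ := exists_continuous_measurable_version hW
  have hdisj : ∀ i j, i ≠ j →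
      leftEnd i + width i ≤ leftEnd j ∨ leftEnd j + width j ≤ leftEnd i := fun i j hij ↦
    (lt_or_gt_of_ne hij).symm.imp leftEnd_add_width_le leftEnd_add_width_le
  have hlen : ∀ k, width k ≠ 0 := fun k ↦ pow_ne_zero _ (by norm_num)
  filter_upwards [hXW, hX.eval_zero_ae_eq_zero, ae_frequently_near hX hm hc (continuous_wave n)
    (wave_zero n) (ε := 1 / 128) (by norm_num) hlen hdisj] with ω h1 h2 h3
  have hpath : (fun s ↦ W s ω) = fun s ↦ X s ω := funext fun s ↦ (h1 s).symm
  have h01 : bridge (fun s ↦ X s ω) 0 = bridge (fun s ↦ X s ω) 1 := by simp [bridge, h2]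
  rw [hpath]
  let f : C(unitInterval, ℝ) := ⟨fun t ↦ cutAtMin (bridge fun s ↦ X s ω) t,
    (continuous_cutAtMin (continuous_bridge (hc ω)) h01).comp continuous_subtype_val⟩
  exact ⟨f, hasSmallStars_of_frequently_near_wave h3 fun _ ↦ rfl, fun _ ↦ rfl⟩

/-! ### Transfer between random paths with the same finite-dimensional distributions -/

/-- The finite-dimensional distributions determine the probability of a Borel set of continuous
paths: the restriction to a dense sequence of times is injective and continuous on the Polish space
of continuous paths, hence maps Borel sets to Borel sets. -/
lemma ae_mem_of_identDistrib {Ω Ω' : Type*} [MeasurableSpace Ω] [MeasurableSpace Ω']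
    {P : Measure Ω} [IsProbabilityMeasure P] {P' : Measure Ω'} {e : Ω → C(unitInterval, ℝ)}
    {Z : Ω' → unitInterval → ℝ}
    (hfdd : ∀ J : Finset unitInterval,
      IdentDistrib (fun ω (t : J) ↦ e ω t) (fun ω' (t : J) ↦ Z ω' t) P P')
    {S : Set C(unitInterval, ℝ)} (hS : MeasurableSet[borel C(unitInterval, ℝ)] S)
    (hZ : ∀ᵐ ω' ∂P', ∃ f ∈ S, ∀ t, f t = Z ω' t) : ∀ᵐ ω ∂P, e ω ∈ S := by
  classical
  borelize C(unitInterval, ℝ)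
  let d : ℕ → unitInterval := TopologicalSpace.denseSeq unitInterval
  have hd : DenseRange d := TopologicalSpace.denseRange_denseSeq _
  have he : AEMeasurable (fun ω i ↦ e ω (d i)) P := aemeasurable_pi_lambda _ fun i ↦
    (measurable_pi_apply (⟨d i, Finset.mem_singleton_self _⟩ : ({d i} : Finset unitInterval))
      ).comp_aemeasurable (hfdd {d i}).aemeasurable_fst
  have hZm : AEMeasurable (fun ω' i ↦ Z ω' (d i)) P' := aemeasurable_pi_lambda _ fun i ↦
    (measurable_pi_apply (⟨d i, Finset.mem_singleton_self _⟩ : ({d i} : Finset unitInterval))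
      ).comp_aemeasurable (hfdd {d i}).aemeasurable_snd
  have hlaw : P.map (fun ω i ↦ e ω (d i)) = P'.map (fun ω' i ↦ Z ω' (d i)) := by
    refine (isProjectiveLimit_map he).unique fun I ↦ ?_
    rw [isProjectiveLimit_map hZm I]
    let u : (I.image d → ℝ) → I → ℝ := fun y i ↦ y ⟨d i, Finset.mem_image_of_mem d i.2⟩
    have hu : Measurable u := measurable_pi_lambda _ fun i ↦ measurable_pi_apply _
    exact ((hfdd (I.image d)).comp hu).map_eq.symm
  let φ : C(unitInterval, ℝ) → ℕ → ℝ := fun f i ↦ f (d i)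
  have hφ : Continuous φ := continuous_pi fun i ↦ continuous_eval_const (d i)
  have hinj : Function.Injective φ := fun f g hfg ↦
    DFunLike.coe_injective (hd.equalizer f.continuous g.continuous hfg)
  have hT : MeasurableSet (φ '' Sᶜ) :=
    hS.compl.image_of_continuousOn_injOn hφ.continuousOn hinj.injOn
  have hnull : P'.map (fun ω' i ↦ Z ω' (d i)) (φ '' Sᶜ) = 0 := by
    rw [Measure.map_apply_of_aemeasurable hZm hT]
    refine measure_mono_null ?_ (ae_iff.1 hZ)
    rintro ω' ⟨g, hg, hgZ⟩ ⟨f, hf, hfZ⟩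
    refine hg (hinj (?_ : φ f = φ g) ▸ hf)
    rw [hgZ]
    exact funext fun i ↦ hfZ (d i)
  rw [← hlaw, Measure.map_apply_of_aemeasurable he hT] at hnull
  refine measure_mono_null ?_ hnull
  intro ω hω
  exact ⟨e ω, hω, rfl⟩

lemma IsBrownianExcursion.ae_hasSmallStars {Ω : Type u} [MeasurableSpace Ω] {P : Measure Ω}
    [IsProbabilityMeasure P] {e : Ω → C(unitInterval, ℝ)} (he : IsBrownianExcursion.{u, v} e P) :
    ∀ᵐ ω ∂P, ∀ n, HasSmallStars n (e ω) := by
  obtain ⟨Ω', _, P', W, hW, hfdd⟩ := he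
  exact ae_all_iff.2 fun n ↦ ae_mem_of_identDistrib hfdd (measurableSet_setOf_hasSmallStars n)
    (ae_exists_hasSmallStars_cutAtMin hW n)

end BrownianCRT

theorem theorem3 {Ω : Type u} [MeasurableSpace Ω] (P : Measure Ω) [IsProbabilityMeasure P]
    (e : Ω → C(unitInterval, ℝ)) (he : IsBrownianExcursion.{u, v} e P) :
    (∃ A η : ℝ, 1 < A ∧ 0 < η ∧ η < (A - 1) / 2 ∧
      ∀ n : ℕ, ∃ A' : ℝ, A ≤ A' ∧
        ∀ᵐ ω ∂P, {x : Fin (n + 1) → ContinuumTree (e ω) | IsApproxStar A' η x}.Infinite) ∧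
    (∀ᵐ ω ∂P, IsStarry (ContinuumTree (e ω))) ∧
    (∀ᵐ ω ∂P, assouadDim (ContinuumTree (e ω)) = ⊤) ∧
    (∀ᵐ ω ∂P, ∀ (Y : Type w) [MetricSpace Y], IsDoubling Y →
      ∀ φ : ContinuumTree (e ω) → Y, ¬ IsQuasisymmetricEmbedding φ) := by
  have h := he.ae_hasSmallStars
  exact ⟨⟨9 / 4, 1 / 4, by norm_num, by norm_num, by norm_num, fun n ↦
    ⟨9 / 4, le_rfl, h.mono fun ω hω ↦ infinite_setOf_isApproxStar hω n⟩⟩,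
    h.mono fun ω hω ↦ isStarry_of_hasSmallStars hω,
    h.mono fun ω hω ↦ assouadDim_eq_top_of_hasSmallStars hω,
    h.mono fun ω hω Y _ hY φ ↦ not_isQuasisymmetricEmbedding_of_hasSmallStars hω hY φ⟩
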